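/- Let $n\in\mathbb N$ and write $\overline{\mathbb R}:=\mathbb R\cup\{\infty\}$. For $f:\mathbb R^n\to\overline{\mathbb R}$, let $\partial f$ denote the limiting subdifferential: $v\in\partial f(x)$ iff $f(x)<\infty$ and there are $x^k\to x$ with $f(x^k)\to f(x)$ and $v^k\to v$ such that, for each $k$, $f(x^k)<\infty$ and $f(y)\ge f(x^k)+\langle v^k,y-x^k\rangle+o(\|y-x^k\|)$ as $y\to x^k$. An operator $A:\mathbb R^n\rightrightarrows\mathbb R^n$ is $(\mu,\rho)$-semimonotone, $\mu,\rho\in\mathbb R$, if $\langle x-x',y-y'\rangle\ge\mu\|x-x'\|^2+\rho\|y-y'\|^2$ for all $x,x'\in\mathbb R^n$, $y\in A(x)$, $y'\in A(x')$. The parallel sum of two operators is $A\,\Box\,B:=(A^{-1}+B^{-1})^{-1}$, and for reals $a,b$, $a\,\Box\,b:=\frac{ab}{a+b}$ if $a+b\neq0$ and $0\,\Box\,0:=0$. **Proposition 4.11 (infimal convolution).** For $i=1,2$ let $f_i:\mathbb R^n\to\overline{\mathbb R}$ be proper lower semicontinuous functions whose subdifferentials $\partial f_i$ are $(\mu_i,\rho_i)$-semimonotone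 with $\mu_i,\rho_i\in\mathbb R$ such that $\mu_1+\mu_2>0$ or $\mu_1=\mu_2=0$. Suppose that for each $r_1\ge0$ and each $\bar s\in\mathbb R^n$ there exists $r_2>0$ such that the set $$\bigl\{(w_1,w_2)\in\mathbb R^n\times\mathbb R^n \;\big|\; f_1(w_1)+f_2(w_2)\le r_1,\ \|w_1+w_2-\bar s\|\le r_2\bigr\}$$ is bounded. Let $\varphi(s):=\inf_{w\in\mathbb R^n}\{f_1(w)+f_2(s-w)\}$ be the infimal convolution of $f_1$ and $f_2$. Then the infimum is attained for every $s\in\mathbb R^n$ (so that $\varphi(s)=\min_{w\in\mathbb R^n}\{f_1(w)+f_2(s-w)\}$), and 1. $\partial\varphi(\bar s)\subseteq(\partial f_1\,\Box\,\partial f_2)(\bar s)$ for every $\bar s\in\mathbb R^n$; 2. $\partial\varphi$ is $(\mu_1\,\Box\,\mu_2,\ \rho_1+\rho_2)$-semimonotone. -/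

import Mathlib

open Filter Topology Pointwise

namespace SemiMon

/-- `n`-dimensional Euclidean space. -/
abbrev Euc (n : ℕ) : Type := EuclideanSpace ℝ (Fin n)

/-- A set-valued operator on `ℝⁿ`; its graph is `{(x, y) | y ∈ A x}`. -/
abbrev SetOp (n : ℕ) : Type := Euc n → Set (Euc n)

/-- The inverse operator: `x ∈ A⁻¹ y` iff `y ∈ A x`. -/
def SetOp.inverse {n : ℕ} (A : SetOp n) : SetOp n :=
  fun y => {x | y ∈ A x}

/-- The sum of two operators, `(A + B) x = A x + B x` (Minkowski sum). -/
def SetOp.sum {n : ℕ} (A B : SetOp n) : SetOp n :=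
  fun x => A x + B x

/-- The parallel sum of two operators, `A □ B = (A⁻¹ + B⁻¹)⁻¹`. -/
def SetOp.parallelSum {n : ℕ} (A B : SetOp n) : SetOp n :=
  SetOp.inverse (SetOp.sum (SetOp.inverse A) (SetOp.inverse B))

/-- `(μ, ρ)`-semimonotonicity of an operator at all points of its graph. -/
def SetOp.Semimonotone {n : ℕ} (A : SetOp n) (μ ρ : ℝ) : Prop :=
  ∀ x' y', y' ∈ A x' → ∀ x y, y ∈ A x →
    μ * ‖x - x'‖ ^ 2 + ρ * ‖y - y'‖ ^ 2 ≤ inner ℝ (x - x') (y - y')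

/-- The parallel sum of two real numbers. It is meaningful when `a = b = 0` or `a + b ≠ 0`. -/
noncomputable def parallelSum (a b : ℝ) : ℝ :=
  open Classical in if a = 0 ∧ b = 0 then 0 else a * b / (a + b)

/-- A proper function `f : ℝⁿ → ℝ ∪ {∞}`: it never takes the value `-∞` and it is finite
at some point. -/
def ProperFun {n : ℕ} (f : Euc n → EReal) : Prop :=
  (∀ x, f x ≠ ⊥) ∧ ∃ x, f x ≠ ⊤

/-- The regular (Fréchet) subdifferential: `v` is a regular subgradient of `f` at `x` if `f x` is
finite and `f y ≥ f x + ⟪v, y - x⟫ + o(‖y - x‖)` as `y → x`. It is empty where `f` is infinite. -/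
def regularSubdifferential {n : ℕ} (f : Euc n → EReal) : SetOp n :=
  fun x => {v | f x ≠ ⊤ ∧ f x ≠ ⊥ ∧ ∀ ε : ℝ, 0 < ε →
    ∀ᶠ y in 𝓝 x, f x + ((inner ℝ v (y - x) - ε * ‖y - x‖ : ℝ) : EReal) ≤ f y}

/-- The limiting (Mordukhovich) subdifferential: limits of regular subgradients along sequences
`xₖ → x` with `f xₖ → f x`. It is empty where `f` is infinite. -/
def limitingSubdifferential {n : ℕ} (f : Euc n → EReal) : SetOp n :=
  fun x => {v | f x ≠ ⊤ ∧ f x ≠ ⊥ ∧ ∃ (xs vs : ℕ → Euc n),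
    Tendsto xs atTop (𝓝 x) ∧ Tendsto (fun k => f (xs k)) atTop (𝓝 (f x)) ∧
    (∀ k, vs k ∈ regularSubdifferential f (xs k)) ∧ Tendsto vs atTop (𝓝 v)}

/-- The infimal convolution `s ↦ inf_w (f₁ w + f₂ (s - w))`. -/
noncomputable def infimalConvolution {n : ℕ} (f₁ f₂ : Euc n → EReal) : Euc n → EReal :=
  fun s => ⨅ w, f₁ w + f₂ (s - w)

end SemiMon

namespace SemiMon

variable {n : ℕ}

/-! If `a + b` is an optimal splitting, then `f₁ + f₂ b` majorizes a translate of φ and touches it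
at `a`, so regular subgradients of φ at `a + b` pass to `f₁` at `a` and, symmetrically, to `f₂` at
`b`. Level boundedness gives optimal splittings and keeps them bounded along a sequence, so they
subconverge; lower semicontinuity makes the limit splitting optimal and the values of each `fᵢ`
converge. Hence limiting subgradients pass too (`exists_mem_limitingSubdifferential`), which is the
inclusion. Adding the two semimonotonicity inequalities at a common pair of subgradients adds the
ρ's; the μ's combine by `parallelSum_mul_norm_add_sq_le`. -/

theorem infimalConvolution_le (f₁ f₂ : Euc n → EReal) (a b : Euc n) :
    infimalConvolution f₁ f₂ (a + b) ≤ f₁ a + f₂ b := by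
  have h := iInf_le (fun w => f₁ w + f₂ (a + b - w)) a
  simpa [infimalConvolution] using h

/-- The uncoupled sum of two functions that avoid `-∞` is lower semicontinuous. -/
theorem lowerSemicontinuous_add_prod {f₁ f₂ : Euc n → EReal}
    (hb₁ : ∀ x, f₁ x ≠ ⊥) (hb₂ : ∀ x, f₂ x ≠ ⊥)
    (h₁ : LowerSemicontinuous f₁) (h₂ : LowerSemicontinuous f₂) :
    LowerSemicontinuous fun p : Euc n × Euc n => f₁ p.1 + f₂ p.2 :=
  (h₁.comp continuous_fst).add' (h₂.comp continuous_snd)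
    fun _ => EReal.continuousAt_add (Or.inr (hb₂ _)) (Or.inl (hb₁ _))

theorem exists_infimalConvolution_eq {f₁ f₂ : Euc n → EReal}
    (hb₁ : ∀ x, f₁ x ≠ ⊥) (hb₂ : ∀ x, f₂ x ≠ ⊥)
    (h₁ : LowerSemicontinuous f₁) (h₂ : LowerSemicontinuous f₂)
    (hlevel : ∀ r₁ : ℝ, 0 ≤ r₁ → ∀ s : Euc n, ∃ r₂ : ℝ, 0 < r₂ ∧
      Bornology.IsBounded {w : Euc n × Euc n |
        f₁ w.1 + f₂ w.2 ≤ (r₁ : EReal) ∧ ‖w.1 + w.2 - s‖ ≤ r₂}) (s : Euc n) :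
    ∃ w, infimalConvolution f₁ f₂ s = f₁ w + f₂ (s - w) := by
  set g : Euc n → EReal := fun w => f₁ w + f₂ (s - w) with hg
  have hlsc : LowerSemicontinuous g :=
    (lowerSemicontinuous_add_prod hb₁ hb₂ h₁ h₂).comp
      (g := fun w : Euc n => (w, s - w)) (by fun_prop)
  suffices ∃ w, ∀ y, g w ≤ g y by
    obtain ⟨w, hw⟩ := this
    exact ⟨w, le_antisymm (iInf_le g w) (le_iInf hw)⟩
  by_cases htop : ∀ y, g y = ⊤
  · exact ⟨0, fun y => by rw [htop y]; exact le_top⟩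
  push Not at htop
  obtain ⟨y₀, hy₀⟩ := htop
  -- The maximum with 0 meets the requirement `0 ≤ r₁` while keeping `y₀` in the sublevel set.
  obtain ⟨r₂, hr₂, hbd⟩ := hlevel (max 0 (g y₀).toReal) (le_max_left _ _) s
  set S : Set (Euc n) := {w | g w ≤ ((max 0 (g y₀).toReal : ℝ) : EReal)} with hS
  have hmem : y₀ ∈ S :=
    (EReal.le_coe_toReal hy₀).trans (EReal.coe_le_coe_iff.2 (le_max_right _ _))
  have hSb : Bornology.IsBounded S := by
    refine (hbd.image_fst).subset ?_
    intro w hw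
    exact ⟨(w, s - w), ⟨hw, by simpa using hr₂.le⟩, rfl⟩
  have hSc : IsCompact S :=
    Metric.isCompact_of_isClosed_isBounded (hlsc.isClosed_preimage _) hSb
  obtain ⟨w, hwS, hw⟩ := (hlsc.lowerSemicontinuousOn S).exists_isMinOn ⟨y₀, hmem⟩ hSc
  refine ⟨w, fun y => ?_⟩
  by_cases hy : y ∈ S
  · exact hw hy
  · exact le_trans hwS (not_le.1 hy).le

/-- If `f + b` majorizes a translate of `g` and touches it at `w`, then regular subgradients of `g`
at the touching point are regular subgradients of `f` at `w`. -/
theorem regularSubdifferential_subset_of_touching {f g : Euc n → EReal} {c w : Euc n} {b : EReal}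
    (hb : b ≠ ⊥) (hf : f w ≠ ⊥) (hle : ∀ y, g (y + c) ≤ f y + b) (heq : g (w + c) = f w + b) :
    regularSubdifferential g (w + c) ⊆ regularSubdifferential f w := by
  rintro v ⟨htop, -, hv⟩
  have hbt : b ≠ ⊤ := by
    rintro rfl
    exact htop (by rw [heq, EReal.add_top_of_ne_bot hf])
  have hft : f w ≠ ⊤ := by
    intro h
    exact htop (by rw [heq, h, EReal.top_add_of_ne_bot hb])
  lift b to ℝ using ⟨hbt, hb⟩
  refine ⟨hft, hf, fun ε hε => ?_⟩
  have ht : Tendsto (fun y : Euc n => y + c) (𝓝 w) (𝓝 (w + c)) :=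
    (continuous_id.add continuous_const).tendsto w
  filter_upwards [ht.eventually (hv ε hε)] with y hy
  have h := hy.trans (hle y)
  rw [heq, add_sub_add_right_eq_sub, add_right_comm] at h
  exact (EReal.addLECancellable_coe b).add_le_add_iff_right.1 h

/-- An asymptotic lower bound on `v` turns the limit of the sum into an upper bound on `u`. This
supplies the convergence of function values that limiting subgradients demand. -/
theorem tendsto_of_tendsto_add {u v : ℕ → EReal} {a b : ℝ}
    (hu : ∀ c : EReal, c < a → ∀ᶠ k in atTop, c < u k)
    (hv : ∀ c : EReal, c < b → ∀ᶠ k in atTop, c < v k)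
    (h : Tendsto (fun k => u k + v k) atTop (𝓝 ((a : EReal) + b))) :
    Tendsto u atTop (𝓝 (a : EReal)) := by
  refine tendsto_order.2 ⟨hu, fun d hd => ?_⟩
  obtain ⟨d', had, hdd⟩ := EReal.lt_iff_exists_real_btwn.1 hd
  have had' : a < d' := EReal.coe_lt_coe_iff.1 had
  -- Giving up half the gap `d' - a` leaves the other half: `u k ≥ d'` would push the sum at least
  -- `(d' - a) / 2` above `a + b`.
  have h1 : ((b - (d' - a) / 2 : ℝ) : EReal) < b := EReal.coe_lt_coe_iff.2 (by linarith)
  have h2 : (a : EReal) + b < ((d' + (b - (d' - a) / 2) : ℝ) : EReal) := by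
    rw [← EReal.coe_add]
    exact EReal.coe_lt_coe_iff.2 (by linarith)
  filter_upwards [hv _ h1, h.eventually_lt_const h2] with k hk1 hk2
  refine lt_trans ?_ hdd
  by_contra! hcon
  have := add_le_add hcon hk1.le
  rw [← EReal.coe_add] at this
  exact absurd hk2 (not_lt.2 this)

/-- A limiting subgradient of the infimal convolution is a limiting subgradient of both functions
at the two parts of some decomposition of the base point. -/
theorem exists_mem_limitingSubdifferential {f₁ f₂ : Euc n → EReal}
    (hb₁ : ∀ x, f₁ x ≠ ⊥) (hb₂ : ∀ x, f₂ x ≠ ⊥)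
    (h₁ : LowerSemicontinuous f₁) (h₂ : LowerSemicontinuous f₂)
    (hlevel : ∀ r₁ : ℝ, 0 ≤ r₁ → ∀ s : Euc n, ∃ r₂ : ℝ, 0 < r₂ ∧
      Bornology.IsBounded {w : Euc n × Euc n |
        f₁ w.1 + f₂ w.2 ≤ (r₁ : EReal) ∧ ‖w.1 + w.2 - s‖ ≤ r₂}) {s v : Euc n}
    (hv : v ∈ limitingSubdifferential (infimalConvolution f₁ f₂) s) :
    ∃ a b, a + b = s ∧ v ∈ limitingSubdifferential f₁ a ∧ v ∈ limitingSubdifferential f₂ b := by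
  obtain ⟨htop, -, xs, vs, hxs, hfxs, hreg, hvs⟩ := hv
  set φ := infimalConvolution f₁ f₂ with hφ
  choose w hw using exists_infimalConvolution_eq hb₁ hb₂ h₁ h₂ hlevel
  -- The `+ 1` makes the level strictly exceed `φ s`, so the values `φ (xs k)` eventually lie below
  -- it.
  obtain ⟨r₂, hr₂, hbd⟩ := hlevel (max 0 ((φ s).toReal + 1)) (le_max_left _ _) s
  have hlt : φ s < ((max 0 ((φ s).toReal + 1) : ℝ) : EReal) :=
    (EReal.le_coe_toReal htop).trans_lt
      (EReal.coe_lt_coe_iff.2 (lt_of_lt_of_le (lt_add_one _) (le_max_right _ _)))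
  have hev : ∀ᶠ k in atTop, (w (xs k), xs k - w (xs k)) ∈ {w : Euc n × Euc n |
      f₁ w.1 + f₂ w.2 ≤ ((max 0 ((φ s).toReal + 1) : ℝ) : EReal) ∧ ‖w.1 + w.2 - s‖ ≤ r₂} := by
    filter_upwards [hfxs.eventually_lt_const hlt, hxs.eventually (Metric.ball_mem_nhds s hr₂)]
      with k hk1 hk2
    refine ⟨?_, ?_⟩
    · rw [← hw (xs k)]; exact hk1.le
    · have : dist (xs k) s < r₂ := hk2
      simpa [dist_eq_norm] using this.le
  obtain ⟨⟨a, b⟩, -, σ, hσ, hlim⟩ := tendsto_subseq_of_frequently_bounded hbd hev.frequently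
  have hσt := hσ.tendsto_atTop
  have ha : Tendsto (fun k => w (xs (σ k))) atTop (𝓝 a) :=
    (continuous_fst.tendsto _).comp hlim
  have hb : Tendsto (fun k => xs (σ k) - w (xs (σ k))) atTop (𝓝 b) :=
    (continuous_snd.tendsto _).comp hlim
  have hab : a + b = s :=
    tendsto_nhds_unique (by simpa [Function.comp_def] using ha.add hb) (hxs.comp hσt)
  have hφσ : Tendsto (fun k => f₁ (w (xs (σ k))) + f₂ (xs (σ k) - w (xs (σ k)))) atTop
      (𝓝 (φ s)) := by
    simpa only [← hw, Function.comp_def] using hfxs.comp hσt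
  have hopt : φ s = f₁ a + f₂ b := by
    refine le_antisymm (hab ▸ infimalConvolution_le f₁ f₂ a b) ?_
    refine le_of_forall_lt fun c hc => lt_of_not_ge fun hcon => ?_
    -- If `φ s < f₁ a + f₂ b`, the values along the splittings would eventually exceed `d` by lower
    -- semicontinuity and stay below `d` by convergence to `φ s`.
    obtain ⟨d, hd1, hd2⟩ := exists_between (lt_of_le_of_lt hcon hc)
    have e1 := hlim.eventually
      (lowerSemicontinuous_add_prod hb₁ hb₂ h₁ h₂ (a, b) d hd2)
    have e2 := hφσ.eventually_lt_const hd1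
    obtain ⟨k, hk1, hk2⟩ := (e1.and e2).exists
    exact lt_asymm hk1 hk2
  have hta : f₁ a ≠ ⊤ := fun h => htop (by rw [hopt, h, EReal.top_add_of_ne_bot (hb₂ b)])
  have htb : f₂ b ≠ ⊤ := fun h => htop (by rw [hopt, h, EReal.add_top_of_ne_bot (hb₁ a)])
  have e1 : ∀ c, c < f₁ a → ∀ᶠ k in atTop, c < f₁ (w (xs (σ k))) :=
    fun c hc => ha.eventually (h₁ a c hc)
  have e2 : ∀ c, c < f₂ b → ∀ᶠ k in atTop, c < f₂ (xs (σ k) - w (xs (σ k))) :=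
    fun c hc => hb.eventually (h₂ b c hc)
  rw [hopt] at hφσ
  have hca := EReal.coe_toReal hta (hb₁ a)
  have hcb := EReal.coe_toReal htb (hb₂ b)
  refine ⟨a, b, hab, ⟨hta, hb₁ a, _, fun k => vs (σ k), ha, ?_, fun k => ?_, hvs.comp hσt⟩,
    ⟨htb, hb₂ b, _, fun k => vs (σ k), hb, ?_, fun k => ?_, hvs.comp hσt⟩⟩
  · rw [← hca] at e1 hφσ ⊢
    rw [← hcb] at e2 hφσ
    exact tendsto_of_tendsto_add e1 e2 hφσ
  · refine regularSubdifferential_subset_of_touching (g := φ)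
      (c := xs (σ k) - w (xs (σ k))) (b := f₂ (xs (σ k) - w (xs (σ k)))) (hb₂ _) (hb₁ _)
      (fun y => infimalConvolution_le f₁ f₂ _ _) ?_ ?_
    · rw [add_sub_cancel]; exact hw _
    · rw [add_sub_cancel]; exact hreg _
  · rw [← hca] at e1 hφσ
    rw [← hcb] at e2 hφσ ⊢
    refine tendsto_of_tendsto_add e2 e1 ?_
    simpa only [add_comm] using hφσ
  · refine regularSubdifferential_subset_of_touching (g := φ)
      (c := w (xs (σ k))) (b := f₁ (w (xs (σ k)))) (hb₁ _) (hb₂ _)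
      (fun y => ?_) ?_ ?_
    · rw [add_comm y, add_comm (f₂ y)]; exact infimalConvolution_le f₁ f₂ _ _
    · rw [sub_add_cancel, add_comm (f₂ _)]; exact hw _
    · rw [sub_add_cancel]; exact hreg _

/-- After multiplication by `μ₁ + μ₂ > 0`, the right side minus the left is exactly `‖μ₁ • x - μ₂ •
y‖ ^ 2`; neither modulus need be nonnegative. -/
theorem parallelSum_mul_norm_add_sq_le {μ₁ μ₂ : ℝ} (hμ : 0 < μ₁ + μ₂ ∨ (μ₁ = 0 ∧ μ₂ = 0))
    (x y : Euc n) :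
    parallelSum μ₁ μ₂ * ‖x + y‖ ^ 2 ≤ μ₁ * ‖x‖ ^ 2 + μ₂ * ‖y‖ ^ 2 := by
  rcases hμ with hμ | ⟨rfl, rfl⟩
  · have h0 : ¬ (μ₁ = 0 ∧ μ₂ = 0) := by
      rintro ⟨rfl, rfl⟩
      simp at hμ
    rw [parallelSum, if_neg h0, div_mul_eq_mul_div, div_le_iff₀ hμ, norm_add_sq_real]
    have h : 0 ≤ ‖μ₁ • x - μ₂ • y‖ ^ 2 := sq_nonneg _
    rw [norm_sub_sq_real, norm_smul, norm_smul, real_inner_smul_left, real_inner_smul_right,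
      mul_pow, mul_pow, Real.norm_eq_abs, Real.norm_eq_abs, sq_abs, sq_abs] at h
    linarith
  · simp [parallelSum]

end SemiMon

theorem proposition4p11 (n : ℕ) (f₁ f₂ : SemiMon.Euc n → EReal) (μ₁ μ₂ ρ₁ ρ₂ : ℝ)
    (hproper₁ : SemiMon.ProperFun f₁) (hproper₂ : SemiMon.ProperFun f₂)
    (hlsc₁ : LowerSemicontinuous f₁) (hlsc₂ : LowerSemicontinuous f₂)
    (hsemi₁ : SemiMon.SetOp.Semimonotone (SemiMon.limitingSubdifferential f₁) μ₁ ρ₁)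
    (hsemi₂ : SemiMon.SetOp.Semimonotone (SemiMon.limitingSubdifferential f₂) μ₂ ρ₂)
    (hμ : 0 < μ₁ + μ₂ ∨ (μ₁ = 0 ∧ μ₂ = 0))
    (hlevel : ∀ r₁ : ℝ, 0 ≤ r₁ → ∀ s : SemiMon.Euc n, ∃ r₂ : ℝ, 0 < r₂ ∧
      Bornology.IsBounded {w : SemiMon.Euc n × SemiMon.Euc n |
        f₁ w.1 + f₂ w.2 ≤ (r₁ : EReal) ∧ ‖w.1 + w.2 - s‖ ≤ r₂}) :
    -- the infimum defining the infimal convolution is a minimum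
    (∀ s, ∃ w, SemiMon.infimalConvolution f₁ f₂ s = f₁ w + f₂ (s - w)) ∧
    (∀ s, SemiMon.limitingSubdifferential (SemiMon.infimalConvolution f₁ f₂) s ⊆
      SemiMon.SetOp.parallelSum (SemiMon.limitingSubdifferential f₁)
        (SemiMon.limitingSubdifferential f₂) s) ∧
    SemiMon.SetOp.Semimonotone
      (SemiMon.limitingSubdifferential (SemiMon.infimalConvolution f₁ f₂))
      (SemiMon.parallelSum μ₁ μ₂) (ρ₁ + ρ₂) := by
  have key := fun s v => SemiMon.exists_mem_limitingSubdifferential hproper₁.1 hproper₂.1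
    hlsc₁ hlsc₂ hlevel (s := s) (v := v)
  refine ⟨SemiMon.exists_infimalConvolution_eq hproper₁.1 hproper₂.1 hlsc₁ hlsc₂ hlevel,
    fun s v hv => ?_, fun x' y' hy' x y hy => ?_⟩
  · obtain ⟨a, b, hab, ha, hb⟩ := key s v hv
    exact ⟨a, ha, b, hb, hab⟩
  · obtain ⟨a, b, rfl, ha, hb⟩ := key x y hy
    obtain ⟨a', b', rfl, ha', hb'⟩ := key x' y' hy'
    have h₁ := hsemi₁ a' y' ha' a y ha
    have h₂ := hsemi₂ b' y' hb' b y hb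
    have h := SemiMon.parallelSum_mul_norm_add_sq_le hμ (a - a') (b - b')
    rw [add_sub_add_comm, inner_add_left]
    linarith
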